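/- Let $(\mathbf{B},\|\cdot\|)$ be a real separable Banach space with its Borel $\sigma$-algebra, and let $\{Y_n;\ n\ge 1\}$ be a sequence of independent $\mathbf{B}$-valued random variables on a probability space. Let $\{Y_n';\ n\ge 1\}$ be an independent copy of $\{Y_n;\ n\ge1\}$ (a sequence of random variables on the same probability space which is independent of $\{Y_n\}$ and has the same law as $\{Y_n\}$, as sequences), and write $\hat Y_n = Y_n - Y_n'$, $n\ge 1$. Let $\{a_n;\ n\ge 1\}$ be a nondecreasing sequence of positive real numbers such that $$\lim_{n\to\infty} a_n=\infty \quad\text{and}\quad \limsup_{n\to\infty}\mathbb{P}\left(\|Y_n\|>\frac{a_n}{2}\right)<\frac12 .$$ Then the following two statements hold. (i) $\displaystyle \frac{\sum_{i=1}^n Y_i-\sum_{i=1}^n\mathbb{E}\left(Y_i I\{\|Y_i\|\le a_n\}\right)}{a_n}\to 0$ in probability as $n\to\infty$ if and only if $\displaystyle \frac{\sum_{i=1}^n \hat Y_i}{a_n}\to 0$ in probability as $n\to\infty$. (ii) $\displaystyle \frac{\sum_{i=1}^n Y_i-\sum_{i=1}^n\mathbb{E}\left(Y_i I\{\|Y_i\|\le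 a_n\}\right)}{a_n}\to 0$ almost surely as $n\to\infty$ if and only if $\displaystyle \frac{\sum_{i=1}^n \hat Y_i}{a_n}\to 0$ almost surely as $n\to\infty$. -/

import Mathlib

open MeasureTheory ProbabilityTheory Filter Topology

open scoped ENNReal

/-! ### First-passage decomposition -/

section Disjointed

variable {α : Type*} {p : ℕ → Set α}

/-! The forward implications are soft: the same centering serves `Y'`, so it cancels in the
difference of the two centered sums.

For the converse of the weak law, the symmetrized partial sums satisfy Lévy's inequality, because
flipping all signs after a first passage preserves the law. Hence a small tail of the full sum makes
all increments Y_i - Y'_i small. The limsup hypothesis keeps P(‖Y_i‖ ≤ a_n/2) at least 1/2, which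
turns this into smallness of P(max ‖Y_i‖ > a_n), so truncating at a_n costs little. The truncated
symmetrized terms are bounded, and a Hoffmann-Jørgensen argument controls the mean norm of their
sum. By Jensen this dominates the mean norm of the truncated sum minus its expectation, and Markov's
inequality concludes (`measure_le_norm_sum_sub_truncated_mean_le`).

For the converse of the strong law, Fubini freezes one path of `Y'` and yields almost sure
convergence with some deterministic centering (`exists_ae_tendsto_inv_smul_sum_sub`). Comparison
with the weak law shows that this centering differs from the truncated means by o(a_n). -/

lemma mem_disjointed_nat {x : α} {k : ℕ} :
    x ∈ disjointed p k ↔ x ∈ p k ∧ ∀ j < k, x ∉ p j := by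
  simp [disjointed_eq_inter_compl]

lemma exists_mem_disjointed_of_mem {x : α} {k : ℕ} (hx : x ∈ p k) :
    ∃ j ≤ k, x ∈ disjointed p j := by
  classical
  have h : ∃ j, x ∈ p j := ⟨k, hx⟩
  exact ⟨Nat.find h, Nat.find_min' h hx,
    mem_disjointed_nat.2 ⟨Nat.find_spec h, fun j hj => Nat.find_min h hj⟩⟩

lemma iUnion_range_disjointed (n : ℕ) :
    ⋃ k ∈ Finset.range n, disjointed p k = ⋃ k ∈ Finset.range n, p k := by
  ext x
  simp only [Set.mem_iUnion, Finset.mem_range, exists_prop]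
  constructor
  · rintro ⟨k, hk, hx⟩
    exact ⟨k, hk, (mem_disjointed_nat.1 hx).1⟩
  · rintro ⟨k, hk, hx⟩
    obtain ⟨j, hj, hxj⟩ := exists_mem_disjointed_of_mem hx
    exact ⟨j, hj.trans_lt hk, hxj⟩

lemma sum_measure_disjointed [MeasurableSpace α] (μ : Measure α)
    (hp : ∀ k, MeasurableSet (p k)) (n : ℕ) :
    ∑ k ∈ Finset.range n, μ (disjointed p k) = μ (⋃ k ∈ Finset.range n, p k) := by
  rw [← iUnion_range_disjointed, measure_biUnion_finset]
  · exact fun i _ j _ hij => disjoint_disjointed p hij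
  · exact fun k _ => MeasurableSet.disjointed hp k

end Disjointed

/-! ### Reflection, Lévy's inequality and mean bounds for symmetric sums -/

section Symmetric

variable {B : Type*} [NormedAddCommGroup B]

/-- Change the signs of all terms of a sequence from the index `k` on. -/
def flipSignFrom (k : ℕ) (x : ℕ → B) : ℕ → B := fun i => if i < k then x i else -x i

/-- The sequences whose partial sum of length `k` has norm larger than `t`. -/
def largePartialSum (B : Type*) [NormedAddCommGroup B] (t : ℝ) (k : ℕ) : Set (ℕ → B) :=
  {x | t < ‖∑ i ∈ Finset.range k, x i‖}

lemma sum_range_flipSignFrom_of_le {k n : ℕ} (h : n ≤ k) (x : ℕ → B) :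
    ∑ i ∈ Finset.range n, flipSignFrom k x i = ∑ i ∈ Finset.range n, x i :=
  Finset.sum_congr rfl fun i hi => by
    simp [flipSignFrom, (Finset.mem_range.1 hi).trans_le h]

lemma sum_range_flipSignFrom_add {k n : ℕ} (h : k ≤ n) (x : ℕ → B) :
    ∑ i ∈ Finset.range n, flipSignFrom k x i + ∑ i ∈ Finset.range n, x i =
      ∑ i ∈ Finset.range k, x i + ∑ i ∈ Finset.range k, x i := by
  rw [← Finset.sum_range_add_sum_Ico (flipSignFrom k x) h, sum_range_flipSignFrom_of_le le_rfl,
    ← Finset.sum_range_add_sum_Ico x h]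
  have : ∑ i ∈ Finset.Ico k n, flipSignFrom k x i = -∑ i ∈ Finset.Ico k n, x i := by
    rw [← Finset.sum_neg_distrib]
    exact Finset.sum_congr rfl fun i hi => by
      simp [flipSignFrom, not_lt.2 (Finset.mem_Ico.1 hi).1]
  rw [this]
  abel

/-- The first passage time is a stopping time. This makes the passage event both invariant under
`flipSignFrom k` and independent of the later terms. -/
lemma mem_disjointed_largePartialSum_congr {t : ℝ} {k : ℕ} {x y : ℕ → B}
    (h : ∀ i < k, x i = y i) :
    x ∈ disjointed (largePartialSum B t) k ↔ y ∈ disjointed (largePartialSum B t) k := by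
  have hS : ∀ j ≤ k, ∑ i ∈ Finset.range j, x i = ∑ i ∈ Finset.range j, y i := fun j hj =>
    Finset.sum_congr rfl fun i hi => h i ((Finset.mem_range.1 hi).trans_le hj)
  simp only [mem_disjointed_nat, largePartialSum, Set.mem_ofPred_eq]
  rw [hS k le_rfl]
  refine and_congr_right fun _ => forall₂_congr fun j hj => ?_
  rw [hS j hj.le]

section Norm

variable [NormedSpace ℝ B]

lemma two_mul_norm_sum_range_le {k n : ℕ} (h : k ≤ n) (x : ℕ → B) :
    2 * ‖∑ i ∈ Finset.range k, x i‖ ≤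
      ‖∑ i ∈ Finset.range n, flipSignFrom k x i‖ + ‖∑ i ∈ Finset.range n, x i‖ := by
  refine le_trans (le_of_eq ?_) (norm_add_le _ _)
  rw [sum_range_flipSignFrom_add h, ← two_smul ℝ (∑ i ∈ Finset.range k, x i), norm_smul]
  simp

lemma two_mul_norm_sum_Ico_le {k n : ℕ} (h : k ≤ n) (x : ℕ → B) :
    2 * ‖∑ i ∈ Finset.Ico k n, x i‖ ≤
      ‖∑ i ∈ Finset.range n, flipSignFrom k x i‖ + ‖∑ i ∈ Finset.range n, x i‖ := by
  have h1 : ∑ i ∈ Finset.Ico k n, x i + ∑ i ∈ Finset.Ico k n, x i =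
      ∑ i ∈ Finset.range n, x i - ∑ i ∈ Finset.range n, flipSignFrom k x i := by
    rw [eq_sub_of_add_eq (sum_range_flipSignFrom_add h x), ← Finset.sum_range_add_sum_Ico x h]
    abel
  calc 2 * ‖∑ i ∈ Finset.Ico k n, x i‖
      = ‖∑ i ∈ Finset.Ico k n, x i + ∑ i ∈ Finset.Ico k n, x i‖ := by
        rw [← two_smul ℝ (∑ i ∈ Finset.Ico k n, x i), norm_smul]
        simp
    _ ≤ _ := by
        rw [h1, add_comm]
        exact norm_sub_le _ _

end Norm

variable [MeasurableSpace B] [BorelSpace B]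

@[fun_prop]
lemma measurable_flipSignFrom (k : ℕ) : Measurable (flipSignFrom k : (ℕ → B) → ℕ → B) := by
  refine measurable_pi_lambda _ fun i => ?_
  unfold flipSignFrom
  split_ifs <;> fun_prop

variable {Ω : Type*} [MeasurableSpace Ω] {P : Measure Ω} {X : ℕ → Ω → B}

/-- The law of a sequence of independent symmetric variables is invariant under sign changes. -/
lemma measurePreserving_flipSignFrom (hX : ∀ i, Measurable (X i)) (hind : iIndepFun X P)
    (hsymm : ∀ i, IdentDistrib (X i) (fun ω => -X i ω) P P) (k : ℕ) :
    MeasurePreserving (flipSignFrom k) (P.map fun ω i => X i ω) (P.map fun ω i => X i ω) := by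
  refine ⟨measurable_flipSignFrom k, ?_⟩
  rw [Measure.map_map (measurable_flipSignFrom k) (measurable_pi_lambda _ hX)]
  have hY := hind.comp (fun i b => if i < k then b else -b)
    (fun i => by split_ifs <;> fun_prop)
  refine ((IdentDistrib.pi (fun i => ?_) hind hY).map_eq).symm
  by_cases h : i < k
  · simpa [h, Function.comp_def] using IdentDistrib.refl (hX i).aemeasurable
  · simpa [h, Function.comp_def] using hsymm i

variable [SecondCountableTopology B]

lemma measurableSet_largePartialSum (t : ℝ) (k : ℕ) :
    MeasurableSet (largePartialSum B t k) :=
  measurableSet_lt measurable_const (by fun_prop)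

lemma lintegral_indicator_enorm_sum_Ico (hX : ∀ i, Measurable (X i)) (hind : iIndepFun X P)
    (t : ℝ) (k n : ℕ) :
    ∫⁻ ω, {ω | (fun i => X i ω) ∈ disjointed (largePartialSum B t) k}.indicator
        (fun ω => ‖∑ i ∈ Finset.Ico k n, X i ω‖ₑ) ω ∂P =
      P {ω | (fun i => X i ω) ∈ disjointed (largePartialSum B t) k} *
        ∫⁻ ω, ‖∑ i ∈ Finset.Ico k n, X i ω‖ₑ ∂P := by
  have hm : Measurable fun ω i => X i ω := measurable_pi_lambda _ hX
  have hD := MeasurableSet.disjointed (measurableSet_largePartialSum (B := B) t) k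
  have hI := hind.indepFun_finset (Finset.range k) (Finset.Ico k n)
    (Finset.range_eq_Ico k ▸ Finset.Ico_disjoint_Ico_consecutive 0 k n) hX
  -- The padding value 0 is immaterial: membership in the passage event ignores coordinates from `k`
  -- on.
  let e : (Finset.range k → B) → ℕ → B :=
    fun y i => if h : i ∈ Finset.range k then y ⟨i, h⟩ else 0
  have he : Measurable e := by
    refine measurable_pi_lambda _ fun i => ?_
    by_cases h : i ∈ Finset.range k
    · simp only [e, h, dite_true]
      fun_prop
    · simp only [e, h, dite_false]
      fun_prop
  have hφ : Measurable fun y => (disjointed (largePartialSum B t) k).indicator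
      (fun _ => (1 : ℝ≥0∞)) (e y) := (measurable_const.indicator hD).comp he
  have hψ : Measurable fun y : Finset.Ico k n → B => ‖∑ i, y i‖ₑ := by fun_prop
  have hI2 := hI.comp hφ hψ
  have h1 : ((fun y => (disjointed (largePartialSum B t) k).indicator
      (fun _ => (1 : ℝ≥0∞)) (e y)) ∘ fun ω (i : Finset.range k) => X i ω) =
      {ω | (fun i => X i ω) ∈ disjointed (largePartialSum B t) k}.indicator 1 := by
    ext ω
    have := mem_disjointed_largePartialSum_congr (t := t) (k := k)
      (x := e fun i => X i ω) (y := fun i => X i ω) fun i hi => by simp [e, hi]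
    by_cases h : (fun i => X i ω) ∈ disjointed (largePartialSum B t) k <;>
      simp [Set.indicator, this, h]
  have h2 : ((fun y : Finset.Ico k n → B => ‖∑ i, y i‖ₑ) ∘
      fun ω (i : Finset.Ico k n) => X i ω) = fun ω => ‖∑ i ∈ Finset.Ico k n, X i ω‖ₑ := by
    ext ω
    simp only [Function.comp_apply]
    rw [Finset.sum_coe_sort (Finset.Ico k n) fun i => X i ω]
  rw [h1, h2] at hI2
  have hset : MeasurableSet {ω | (fun i => X i ω) ∈ disjointed (largePartialSum B t) k} := hm hD
  have := lintegral_mul_eq_lintegral_mul_lintegral_of_indepFun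
    (measurable_one.indicator hset) (by fun_prop) hI2
  rw [lintegral_indicator_one hset] at this
  rw [← this]
  refine lintegral_congr fun ω => ?_
  by_cases h : (fun i => X i ω) ∈ disjointed (largePartialSum B t) k <;>
    simp [Set.indicator, h]

variable [NormedSpace ℝ B]

/-- **Lévy's inequality** for the law of a sequence that is invariant under changes of sign. -/
lemma measure_iUnion_largePartialSum_le (μ : Measure (ℕ → B))
    (hμ : ∀ k, MeasurePreserving (flipSignFrom k) μ μ) (t : ℝ) (n : ℕ) :
    μ (⋃ k ∈ Finset.range (n + 1), largePartialSum B t k) ≤ 2 * μ (largePartialSum B t n) := by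
  have hD := MeasurableSet.disjointed (measurableSet_largePartialSum (B := B) t)
  have key : ∀ k ∈ Finset.range (n + 1), μ (disjointed (largePartialSum B t) k) ≤
      2 * μ (disjointed (largePartialSum B t) k ∩ largePartialSum B t n) := by
    intro k hk
    have hkn : k ≤ n := Nat.lt_succ_iff.1 (Finset.mem_range.1 hk)
    set E := disjointed (largePartialSum B t) k ∩ largePartialSum B t n
    have hE : MeasurableSet E := (hD k).inter (measurableSet_largePartialSum t n)
    -- Twice the sum at passage is the final sum plus the reflected final sum, so one of these two
    -- has norm above `t`.
    have hsub : disjointed (largePartialSum B t) k ⊆ E ∪ flipSignFrom k ⁻¹' E := by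
      intro x hx
      by_cases hxn : x ∈ largePartialSum B t n
      · exact Or.inl ⟨hx, hxn⟩
      · refine Or.inr ⟨?_, ?_⟩
        · exact (mem_disjointed_largePartialSum_congr
            fun i hi => by simp [flipSignFrom, hi]).2 hx
        · have h1 := (mem_disjointed_nat.1 hx).1
          have h2 := two_mul_norm_sum_range_le hkn x
          simp only [largePartialSum, Set.mem_ofPred_eq, not_lt] at h1 hxn ⊢
          linarith
    calc μ (disjointed (largePartialSum B t) k) ≤ μ E + μ (flipSignFrom k ⁻¹' E) :=
          (measure_mono hsub).trans (measure_union_le _ _)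
      _ = 2 * μ E := by rw [(hμ k).measure_preimage hE.nullMeasurableSet, two_mul]
  rw [← sum_measure_disjointed μ (measurableSet_largePartialSum t)]
  refine (Finset.sum_le_sum key).trans ?_
  rw [← Finset.mul_sum]
  gcongr
  rw [← measure_biUnion_finset]
  · exact measure_mono (Set.iUnion₂_subset fun k _ => Set.inter_subset_right)
  · exact fun i _ j _ hij => (disjoint_disjointed _ hij).mono Set.inter_subset_left
      Set.inter_subset_left
  · exact fun k _ => (hD k).inter (measurableSet_largePartialSum t n)

/-- **Lévy's inequality** for independent symmetric random variables. -/
lemma measure_exists_lt_norm_sum_le (hX : ∀ i, Measurable (X i)) (hind : iIndepFun X P)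
    (hsymm : ∀ i, IdentDistrib (X i) (fun ω => -X i ω) P P) (t : ℝ) (n : ℕ) :
    P {ω | ∃ k ≤ n, t < ‖∑ i ∈ Finset.range k, X i ω‖} ≤
      2 * P {ω | t < ‖∑ i ∈ Finset.range n, X i ω‖} := by
  have h := measure_iUnion_largePartialSum_le _
    (measurePreserving_flipSignFrom hX hind hsymm) t n
  have hm : Measurable fun ω i => X i ω := measurable_pi_lambda _ hX
  rw [Measure.map_apply hm (measurableSet_largePartialSum t n), Measure.map_apply hm
    (Finset.measurableSet_biUnion _ fun k _ => measurableSet_largePartialSum t k)] at h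
  refine le_trans (measure_mono fun ω hω => ?_) h
  obtain ⟨k, hk, hω⟩ := hω
  exact Set.mem_iUnion₂.2 ⟨k, Finset.mem_range.2 (Nat.lt_succ_iff.2 hk), hω⟩

/-- The block is half the difference of the full sum and its reflection, which have the same law. -/
lemma lintegral_enorm_sum_Ico_le (hX : ∀ i, Measurable (X i)) (hind : iIndepFun X P)
    (hsymm : ∀ i, IdentDistrib (X i) (fun ω => -X i ω) P P) {k n : ℕ} (hkn : k ≤ n) :
    ∫⁻ ω, ‖∑ i ∈ Finset.Ico k n, X i ω‖ₑ ∂P ≤ ∫⁻ ω, ‖∑ i ∈ Finset.range n, X i ω‖ₑ ∂P := by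
  have hm : Measurable fun ω i => X i ω := measurable_pi_lambda _ hX
  have hflip := measurePreserving_flipSignFrom hX hind hsymm k
  have hg : Measurable fun x : ℕ → B => ‖∑ i ∈ Finset.range n, x i‖ₑ := by fun_prop
  have heq : ∫⁻ ω, ‖∑ i ∈ Finset.range n, flipSignFrom k (fun i => X i ω) i‖ₑ ∂P =
      ∫⁻ ω, ‖∑ i ∈ Finset.range n, X i ω‖ₑ ∂P := by
    have := hflip.lintegral_comp hg
    rwa [lintegral_map (by fun_prop) hm, lintegral_map hg hm] at this
  have hle : ∀ ω, 2 * ‖∑ i ∈ Finset.Ico k n, X i ω‖ₑ ≤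
      ‖∑ i ∈ Finset.range n, flipSignFrom k (fun i => X i ω) i‖ₑ +
        ‖∑ i ∈ Finset.range n, X i ω‖ₑ := by
    intro ω
    have := ENNReal.ofReal_le_ofReal (two_mul_norm_sum_Ico_le hkn fun i => X i ω)
    rw [ENNReal.ofReal_mul zero_le_two, ENNReal.ofReal_add (norm_nonneg _) (norm_nonneg _)] at this
    simpa [ofReal_norm] using this
  have h2 := lintegral_mono (μ := P) hle
  rw [lintegral_const_mul _ (by fun_prop), lintegral_add_right _ (by fun_prop), heq,
    ← two_mul] at h2
  exact (ENNReal.mul_le_mul_iff_right two_ne_zero ENNReal.ofNat_ne_top).1 h2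

variable [IsProbabilityMeasure P]

/-- A form of the **Hoffmann-Jørgensen inequality** for bounded independent symmetric variables. -/
lemma lintegral_enorm_sum_le_add_mul (hX : ∀ i, Measurable (X i)) (hind : iIndepFun X P)
    (hsymm : ∀ i, IdentDistrib (X i) (fun ω => -X i ω) P P) {c t : ℝ} (ht : 0 ≤ t)
    (hc : ∀ i ω, ‖X i ω‖ ≤ c) (n : ℕ) :
    ∫⁻ ω, ‖∑ i ∈ Finset.range n, X i ω‖ₑ ∂P ≤ ENNReal.ofReal t +
      P {ω | ∃ k ≤ n, t < ‖∑ i ∈ Finset.range k, X i ω‖} *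
        (ENNReal.ofReal c + ∫⁻ ω, ‖∑ i ∈ Finset.range n, X i ω‖ₑ ∂P) := by
  have hm : Measurable fun ω i => X i ω := measurable_pi_lambda _ hX
  let A : ℕ → Set Ω := fun k => {ω | (fun i => X i ω) ∈ disjointed (largePartialSum B t) k}
  have hA : ∀ k, MeasurableSet (A k) := fun k =>
    hm (MeasurableSet.disjointed (measurableSet_largePartialSum (B := B) t) k)
  have hsum : ∑ k ∈ Finset.range (n + 1), P (A k) =
      P {ω | ∃ k ≤ n, t < ‖∑ i ∈ Finset.range k, X i ω‖} := by
    have h := sum_measure_disjointed (P.map fun ω i => X i ω)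
      (measurableSet_largePartialSum (B := B) t) (n + 1)
    rw [Measure.map_apply hm
      (Finset.measurableSet_biUnion _ fun k _ => measurableSet_largePartialSum t k)] at h
    convert h using 2
    · rw [Measure.map_apply hm (MeasurableSet.disjointed (measurableSet_largePartialSum t) _)]
      rfl
    · ext ω
      simp [largePartialSum]
  -- At first passage `k = m + 1`, the sum before the jump is at most `t`, the jump `X m` at most
  -- `c`, and the rest is a block independent of the passage.
  have hpt : ∀ ω, ‖∑ i ∈ Finset.range n, X i ω‖ₑ ≤ ENNReal.ofReal t +
      ∑ k ∈ Finset.range (n + 1), ((A k).indicator (fun _ => ENNReal.ofReal c) ω +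
        (A k).indicator (fun ω => ‖∑ i ∈ Finset.Ico k n, X i ω‖ₑ) ω) := by
    intro ω
    by_cases hω : t < ‖∑ i ∈ Finset.range n, X i ω‖
    · obtain ⟨k, hk, hx⟩ := exists_mem_disjointed_of_mem
        (p := largePartialSum B t) (x := fun i => X i ω) (k := n) hω
      have hk0 : k ≠ 0 := by
        rintro rfl
        have := (mem_disjointed_nat.1 hx).1
        simp only [largePartialSum, Set.mem_ofPred_eq, Finset.range_zero, Finset.sum_empty,
          norm_zero] at this
        exact this.not_ge ht
      obtain ⟨m, rfl⟩ := Nat.exists_eq_succ_of_ne_zero hk0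
      have hprev : ‖∑ i ∈ Finset.range m, X i ω‖ ≤ t :=
        not_lt.1 ((mem_disjointed_nat.1 hx).2 m m.lt_succ_self)
      have hbd : ‖∑ i ∈ Finset.range n, X i ω‖ ≤
          t + (c + ‖∑ i ∈ Finset.Ico (m + 1) n, X i ω‖) := by
        rw [← Finset.sum_range_add_sum_Ico (fun i => X i ω) hk, Finset.sum_range_succ]
        refine (norm_add_le _ _).trans ?_
        have := norm_add_le (∑ i ∈ Finset.range m, X i ω) (X m ω)
        have := hc m ω
        linarith
      have hc0 : 0 ≤ c := (norm_nonneg _).trans (hc 0 ω)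
      refine le_trans ?_ (add_le_add_right (Finset.single_le_sum (fun _ _ => zero_le)
        (Finset.mem_range.2 (Nat.lt_succ_iff.2 hk))) _)
      have hAω : ω ∈ A (m + 1) := hx
      simp only [Set.indicator_of_mem hAω, Nat.succ_eq_add_one]
      have := ENNReal.ofReal_le_ofReal hbd
      rwa [ENNReal.ofReal_add ht (by positivity), ENNReal.ofReal_add hc0 (norm_nonneg _),
        ofReal_norm, ofReal_norm] at this
    · refine le_add_right ?_
      rw [← ofReal_norm]
      exact ENNReal.ofReal_le_ofReal (not_lt.1 hω)
  refine (lintegral_mono hpt).trans ?_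
  have hmeas : ∀ k ∈ Finset.range (n + 1), Measurable fun ω =>
      (A k).indicator (fun _ => ENNReal.ofReal c) ω +
        (A k).indicator (fun ω => ‖∑ i ∈ Finset.Ico k n, X i ω‖ₑ) ω := fun k _ =>
    (measurable_const.indicator (hA k)).add (Measurable.indicator (by fun_prop) (hA k))
  rw [lintegral_add_left measurable_const, lintegral_const, measure_univ, mul_one,
    lintegral_finsetSum _ hmeas, ← hsum, Finset.sum_mul]
  gcongr with k hk
  rw [lintegral_add_left (measurable_const.indicator (hA k)), lintegral_indicator_const (hA k),
    lintegral_indicator_enorm_sum_Ico hX hind, mul_comm, ← mul_add]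
  exact mul_le_mul_right (add_le_add_right (lintegral_enorm_sum_Ico_le hX hind hsymm
    (Nat.lt_succ_iff.1 (Finset.mem_range.1 hk))) _) _

/-- If the partial sums are unlikely to exceed `t`, the mean of the norm of the sum is small. -/
lemma lintegral_enorm_sum_le_of_measure_le (hX : ∀ i, Measurable (X i)) (hind : iIndepFun X P)
    (hsymm : ∀ i, IdentDistrib (X i) (fun ω => -X i ω) P P) {c t : ℝ} (ht : 0 ≤ t)
    (hc : ∀ i ω, ‖X i ω‖ ≤ c) (n : ℕ) {q : ℝ≥0∞}
    (hq : P {ω | t < ‖∑ i ∈ Finset.range n, X i ω‖} ≤ q) (hq4 : q ≤ 4⁻¹) :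
    ∫⁻ ω, ‖∑ i ∈ Finset.range n, X i ω‖ₑ ∂P ≤
      2 * ENNReal.ofReal t + 4 * q * ENNReal.ofReal c := by
  set E := ∫⁻ ω, ‖∑ i ∈ Finset.range n, X i ω‖ₑ ∂P
  -- Finiteness is what allows `E` to be cancelled at the end.
  have hE : E ≠ ∞ := by
    have hb : ∀ ω, ‖∑ i ∈ Finset.range n, X i ω‖ₑ ≤ ENNReal.ofReal (n * c) := fun ω => by
      rw [← ofReal_norm]
      refine ENNReal.ofReal_le_ofReal ((norm_sum_le _ _).trans ?_)
      exact (Finset.sum_le_sum fun i _ => hc i ω).trans (by simp)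
    refine ne_top_of_le_ne_top ?_ (lintegral_mono hb)
    simpa using ENNReal.mul_ne_top (ENNReal.natCast_ne_top n) ENNReal.ofReal_ne_top
  have h := lintegral_enorm_sum_le_add_mul hX hind hsymm ht hc n
  have hp := (measure_exists_lt_norm_sum_le hX hind hsymm t n).trans (mul_le_mul_right hq 2)
  have h2 : 2 * (2 * q) * E ≤ E := by
    rw [← mul_assoc]
    refine (mul_le_mul_left (mul_le_mul_right hq4 _) E).trans ?_
    have : (2 * 2 * 4⁻¹ : ℝ≥0∞) = 1 := by
      norm_num
      exact ENNReal.mul_inv_cancel (by norm_num) (by norm_num)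
    rw [this, one_mul]
  have h3 : E ≤ ENNReal.ofReal t + (2 * q * ENNReal.ofReal c + 2 * q * E) := by
    refine h.trans ?_
    rw [← mul_add]
    gcongr
  have h4 : E + E ≤ 2 * ENNReal.ofReal t + 4 * q * ENNReal.ofReal c + E := by
    calc E + E = 2 * E := (two_mul E).symm
      _ ≤ 2 * (ENNReal.ofReal t + (2 * q * ENNReal.ofReal c + 2 * q * E)) := by gcongr
      _ = 2 * ENNReal.ofReal t + 4 * q * ENNReal.ofReal c + 2 * (2 * q) * E := by ring
      _ ≤ _ := by gcongr
  exact (ENNReal.add_le_add_iff_right hE).1 h4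

end Symmetric

/-! ### Symmetrization by an independent copy -/

section IndependentCopy

variable {Ω : Type*} [MeasurableSpace Ω] {P : Measure Ω}

lemma iIndepFun_of_identDistrib {β : Type*} [MeasurableSpace β] {Y Y' : ℕ → Ω → β}
    (hindep : iIndepFun Y P)
    (hcopy : IdentDistrib (fun ω i => Y' i ω) (fun ω i => Y i ω) P P) : iIndepFun Y' P := by
  rw [iIndepFun_iff_measure_inter_preimage_eq_mul] at hindep ⊢
  intro S sets hsets
  have hset : MeasurableSet (⋂ i ∈ S, (fun x : ℕ → β => x i) ⁻¹' sets i) :=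
    Finset.measurableSet_biInter _ fun i hi => measurable_pi_apply i (hsets i hi)
  have h := hcopy.measure_mem_eq hset
  simp only [Set.preimage_iInter] at h
  refine (h.trans (hindep S hsets)).trans (Finset.prod_congr rfl fun i hi => ?_)
  exact ((hcopy.comp (measurable_pi_apply i)).measure_mem_eq (hsets i hi)).symm

/-- Rectangles form a generating π-system, and on them the probability factors first between the two
sequences, then along the indices. -/
lemma iIndepFun_prodMk {ι β γ : Type*} [MeasurableSpace β] [MeasurableSpace γ]
    {Y : ι → Ω → β} {Z : ι → Ω → γ} (hY : ∀ i, Measurable (Y i)) (hZ : ∀ i, Measurable (Z i))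
    (hYind : iIndepFun Y P) (hZind : iIndepFun Z P)
    (hYZ : IndepFun (fun ω i => Y i ω) (fun ω i => Z i ω) P) :
    iIndepFun (fun i ω => (Y i ω, Z i ω)) P := by
  refine iIndepSets.iIndep (fun i => ((hY i).prodMk (hZ i)).comap_le)
    (fun i => {s | ∃ t ∈ Set.image2 (· ×ˢ ·) {s : Set β | MeasurableSet s}
      {t : Set γ | MeasurableSet t}, (fun ω => (Y i ω, Z i ω)) ⁻¹' t = s})
    (fun i => isPiSystem_prod.comap _) (fun i => ?_) ?_
  · rw [← generateFrom_prod, MeasurableSpace.comap_generateFrom]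
    rfl
  · rw [iIndepSets_iff]
    intro S f hf
    have hf' : ∀ i, ∃ u : Set β, ∃ v : Set γ, i ∈ S →
        MeasurableSet u ∧ MeasurableSet v ∧ f i = Y i ⁻¹' u ∩ Z i ⁻¹' v := by
      intro i
      by_cases hi : i ∈ S
      · obtain ⟨_, ⟨u, hu, v, hv, rfl⟩, h⟩ := hf i hi
        exact ⟨u, v, fun _ => ⟨hu, hv, h.symm⟩⟩
      · exact ⟨∅, ∅, fun h => absurd h hi⟩
    choose u v huv using hf'
    have hu : MeasurableSet (⋂ i ∈ S, (fun x : ι → β => x i) ⁻¹' u i) :=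
      Finset.measurableSet_biInter _ fun i hi => measurable_pi_apply i (huv i hi).1
    have hv : MeasurableSet (⋂ i ∈ S, (fun x : ι → γ => x i) ⁻¹' v i) :=
      Finset.measurableSet_biInter _ fun i hi => measurable_pi_apply i (huv i hi).2.1
    have h := hYZ.measure_inter_preimage_eq_mul _ _ hu hv
    simp only [Set.preimage_iInter] at h
    have h1 := hYind.measure_inter_preimage_eq_mul S fun i hi => (huv i hi).1
    have h2 := hZind.measure_inter_preimage_eq_mul S fun i hi => (huv i hi).2.1
    have hfS : ⋂ i ∈ S, f i = (⋂ i ∈ S, Y i ⁻¹' u i) ∩ ⋂ i ∈ S, Z i ⁻¹' v i := by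
      ext ω
      simp only [Set.mem_iInter, Set.mem_inter_iff]
      constructor
      · intro hω
        have h' := fun i hi => (huv i hi).2.2 ▸ hω i hi
        exact ⟨fun i hi => (h' i hi).1, fun i hi => (h' i hi).2⟩
      · rintro ⟨hω, hω'⟩ i hi
        rw [(huv i hi).2.2]
        exact ⟨hω i hi, hω' i hi⟩
    rw [hfS]
    refine h.trans ?_
    refine (congrArg₂ (· * ·) h1 h2).trans ?_
    rw [← Finset.prod_mul_distrib]
    refine Finset.prod_congr rfl fun i hi => ?_
    rw [(huv i hi).2.2]
    have hi' := hYZ.comp (measurable_pi_apply i) (measurable_pi_apply i)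
    exact (hi'.measure_inter_preimage_eq_mul _ _ (huv i hi).1 (huv i hi).2.1).symm

variable {B : Type*} [NormedAddCommGroup B] [MeasurableSpace B] [BorelSpace B]
  {Y Y' : ℕ → Ω → B}

/-- A maximal form of the weak symmetrization inequality. -/
lemma measure_exists_lt_norm_le_symmetrization (hY : ∀ i, Measurable (Y i))
    (hY' : ∀ i, Measurable (Y' i))
    (hcopy : IdentDistrib (fun ω i => Y' i ω) (fun ω i => Y i ω) P P)
    (hcopy_indep : IndepFun (fun ω i => Y i ω) (fun ω i => Y' i ω) P)
    [IsProbabilityMeasure P] {s : ℝ} {n : ℕ}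
    (hn : ∀ i < n, P {ω | s / 2 < ‖Y i ω‖} ≤ 2⁻¹) :
    P {ω | ∃ i < n, s < ‖Y i ω‖} ≤ 2 * P {ω | ∃ i < n, s / 2 < ‖Y i ω - Y' i ω‖} := by
  let p : ℕ → Set (ℕ → B) := fun i => {x | s < ‖x i‖}
  have hp : ∀ i, MeasurableSet (p i) := fun i => measurableSet_lt measurable_const (by fun_prop)
  have hD := MeasurableSet.disjointed hp
  have hm : Measurable fun ω i => Y i ω := measurable_pi_lambda _ hY
  let q : ℕ → Set (ℕ → B) := fun i => {x | ‖x i‖ ≤ s / 2}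
  have hq : ∀ i, MeasurableSet (q i) := fun i => measurableSet_le (by fun_prop) measurable_const
  have hm' : Measurable fun ω i => Y' i ω := measurable_pi_lambda _ hY'
  have hhalf : ∀ i < n, 1 ≤ 2 * P ((fun ω i => Y' i ω) ⁻¹' q i) := by
    intro i hi
    rw [hcopy.measure_mem_eq (hq i)]
    have h1 : P ((fun ω i => Y i ω) ⁻¹' q i) + P {ω | s / 2 < ‖Y i ω‖} = 1 := by
      rw [← prob_add_prob_compl (μ := P) (hm (hq i))]
      congr 2
      ext ω
      simp [q]
    have h2 : (2⁻¹ : ℝ≥0∞) ≤ P ((fun ω i => Y i ω) ⁻¹' q i) := by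
      have : (2⁻¹ : ℝ≥0∞) + 2⁻¹ ≤ P ((fun ω i => Y i ω) ⁻¹' q i) + 2⁻¹ := by
        rw [ENNReal.inv_two_add_inv_two, ← h1]
        gcongr
        exact hn i hi
      exact (ENNReal.add_le_add_iff_right (by simp)).1 this
    calc (1 : ℝ≥0∞) = 2 * 2⁻¹ := (ENNReal.mul_inv_cancel two_ne_zero ENNReal.ofNat_ne_top).symm
      _ ≤ _ := by gcongr
  -- Here `i` is the first index at which `Y` exceeds `s`, while `Y'` stays below `s / 2` there;
  -- independence costs only a factor 2.
  let E : ℕ → Set Ω := fun i =>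
    (fun ω i => Y i ω) ⁻¹' disjointed p i ∩ (fun ω i => Y' i ω) ⁻¹' q i
  have hkey : ∀ i ∈ Finset.range n, (P.map fun ω i => Y i ω) (disjointed p i) ≤ 2 * P (E i) := by
    intro i hi
    rw [Measure.map_apply hm (hD i),
      hcopy_indep.measure_inter_preimage_eq_mul _ _ (hD i) (hq i), mul_left_comm]
    exact le_mul_of_one_le_right' (hhalf i (Finset.mem_range.1 hi))
  calc P {ω | ∃ i < n, s < ‖Y i ω‖}
      = (P.map fun ω i => Y i ω) (⋃ i ∈ Finset.range n, p i) := by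
        rw [Measure.map_apply hm (Finset.measurableSet_biUnion _ fun i _ => hp i)]
        congr 1
        ext ω
        simp [p]
    _ ≤ ∑ i ∈ Finset.range n, 2 * P (E i) := by
        rw [← sum_measure_disjointed _ hp]
        exact Finset.sum_le_sum hkey
    _ = 2 * P (⋃ i ∈ Finset.range n, E i) := by
        rw [← Finset.mul_sum, measure_biUnion_finset]
        · exact fun i _ j _ hij => ((disjoint_disjointed p hij).preimage _).mono
            Set.inter_subset_left Set.inter_subset_left
        · exact fun i _ => (hm (hD i)).inter (hm' (hq i))
    _ ≤ _ := by
        gcongr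
        refine Set.iUnion₂_subset fun i hi ω hω => ⟨i, Finset.mem_range.1 hi, ?_⟩
        have h1 : s < ‖Y i ω‖ := (mem_disjointed_nat.1 hω.1).1
        have h2 : ‖Y' i ω‖ ≤ s / 2 := hω.2
        have h3 := norm_sub_norm_le (Y i ω) (Y' i ω)
        linarith

variable [SecondCountableTopology B] [NormedSpace ℝ B]

/-- Centering at the mean is dominated by symmetrization. -/
lemma lintegral_enorm_sub_integral_le [IsProbabilityMeasure P] {Z Z' : Ω → B}
    (hZ : Measurable Z) (hZ' : Measurable Z') (hint : Integrable Z P)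
    (hcopy : IdentDistrib Z' Z P P) (hind : IndepFun Z Z' P) [CompleteSpace B] :
    ∫⁻ ω, ‖Z ω - ∫ ω', Z ω' ∂P‖ₑ ∂P ≤ ∫⁻ ω, ‖Z ω - Z' ω‖ₑ ∂P := by
  have hprod := (indepFun_iff_map_prod_eq_prod_map_map hZ.aemeasurable hZ'.aemeasurable).1 hind
  have : IsProbabilityMeasure (P.map Z) := Measure.isProbabilityMeasure_map hZ.aemeasurable
  rw [hcopy.map_eq] at hprod
  have hidint : Integrable (fun y => y) (P.map Z) :=
    (integrable_map_measure (by fun_prop) hZ.aemeasurable).2 hint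
  have h1 : ∫⁻ ω, ‖Z ω - Z' ω‖ₑ ∂P = ∫⁻ x, ∫⁻ y, ‖x - y‖ₑ ∂(P.map Z) ∂(P.map Z) := by
    rw [← lintegral_prod (fun z : B × B => ‖z.1 - z.2‖ₑ) (by fun_prop), ← hprod,
      lintegral_map (by fun_prop) (by fun_prop)]
  have h2 : ∫ ω', Z ω' ∂P = ∫ y, y ∂(P.map Z) := (integral_map hZ.aemeasurable
    (f := fun y => y) (by fun_prop)).symm
  rw [h1, h2, ← lintegral_map (f := fun x => ‖x - ∫ y, y ∂(P.map Z)‖ₑ) (by fun_prop) hZ]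
  refine lintegral_mono fun x => ?_
  -- Jensen: the mean over the copy is taken inside the norm.
  have h3 : x - ∫ y, y ∂(P.map Z) = ∫ y, (x - y) ∂(P.map Z) := by
    rw [integral_sub (integrable_const x) hidint]
    simp
  rw [h3]
  exact enorm_integral_le_lintegral_enorm _

/-- A quantitative comparison of the sum centered at its truncated mean with its
symmetrization. -/
lemma measure_le_norm_sum_sub_truncated_mean_le [IsProbabilityMeasure P] [CompleteSpace B]
    (hY : ∀ i, Measurable (Y i)) (hY' : ∀ i, Measurable (Y' i)) (hindep : iIndepFun Y P)
    (hcopy : IdentDistrib (fun ω i => Y' i ω) (fun ω i => Y i ω) P P)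
    (hcopy_indep : IndepFun (fun ω i => Y i ω) (fun ω i => Y' i ω) P)
    {s ε δ : ℝ} (hs : 0 < s) (hε : 0 < ε) (hε4 : ε ≤ 4⁻¹) (hδ : 0 < δ) {n : ℕ}
    (hn : ∀ i < n, P {ω | s / 2 < ‖Y i ω‖} ≤ 2⁻¹)
    {u : ℝ≥0∞} (hu : P {ω | ε * s < ‖∑ i ∈ Finset.range n, (Y i ω - Y' i ω)‖} ≤ u)
    (hu9 : 9 * u ≤ 4⁻¹) :
    P {ω | δ * s ≤ ‖∑ i ∈ Finset.range n, Y i ω -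
        ∑ i ∈ Finset.range n, ∫ ω', {x | ‖Y i x‖ ≤ s}.indicator (Y i) ω' ∂P‖} ≤
      4 * u + (2 * ENNReal.ofReal ε + 72 * u) / ENNReal.ofReal δ := by
  have hindep' := iIndepFun_of_identDistrib hindep hcopy
  have hpair := iIndepFun_prodMk hY hY' hindep hindep' hcopy_indep
  have hid : ∀ i, IdentDistrib (Y' i) (Y i) P P := fun i => hcopy.comp (measurable_pi_apply i)
  have hii : ∀ i, IndepFun (Y i) (Y' i) P := fun i =>
    hcopy_indep.comp (measurable_pi_apply i) (measurable_pi_apply i)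
  have hswap : ∀ i, IdentDistrib (fun ω => (Y i ω, Y' i ω)) (fun ω => (Y' i ω, Y i ω)) P P :=
    fun i => (hid i).symm.prodMk (hid i) (hii i) (hii i).symm
  -- symmetrized variables
  have hsub_ind : iIndepFun (fun i ω => Y i ω - Y' i ω) P :=
    hpair.comp (fun _ z => z.1 - z.2) fun _ => by fun_prop
  have hsub_symm : ∀ i, IdentDistrib (fun ω => Y i ω - Y' i ω)
      (fun ω => -(Y i ω - Y' i ω)) P P := fun i => by
    have := (hswap i).comp (u := fun z : B × B => z.1 - z.2) (by fun_prop)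
    simpa [Function.comp_def] using this
  have hlarge : P {ω | ∃ i < n, s < ‖Y i ω‖} ≤ 4 * u := by
    refine (measure_exists_lt_norm_le_symmetrization hY hY' hcopy hcopy_indep hn).trans ?_
    -- An increment above `s / 2` forces one of two consecutive partial sums above `s / 4`, hence
    -- above `ε * s`.
    have h1 : {ω | ∃ i < n, s / 2 < ‖Y i ω - Y' i ω‖} ⊆
        {ω | ∃ k ≤ n, ε * s < ‖∑ i ∈ Finset.range k, (Y i ω - Y' i ω)‖} := by
      rintro ω ⟨i, hi, hω⟩
      by_contra hcon
      have hcon' : ∀ k ≤ n, ‖∑ i ∈ Finset.range k, (Y i ω - Y' i ω)‖ ≤ ε * s := fun k hk =>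
        not_lt.1 fun h => hcon ⟨k, hk, h⟩
      have h2 := norm_sub_le (∑ i ∈ Finset.range (i + 1), (Y i ω - Y' i ω))
        (∑ i ∈ Finset.range i, (Y i ω - Y' i ω))
      rw [Finset.sum_range_succ_sub_sum] at h2
      have h3 := hcon' i hi.le
      have h4 := hcon' (i + 1) hi
      have h5 : ε * s ≤ 4⁻¹ * s := by gcongr
      linarith
    calc 2 * P {ω | ∃ i < n, s / 2 < ‖Y i ω - Y' i ω‖} ≤ 2 * (2 * u) := by
          gcongr
          refine (measure_mono h1).trans ((measure_exists_lt_norm_sum_le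
            (X := fun i ω => Y i ω - Y' i ω)
            (fun i => (hY i).sub (hY' i)) hsub_ind hsub_symm (ε * s) n).trans ?_)
          gcongr
      _ = 4 * u := by ring
  have hlarge' : P {ω | ∃ i < n, s < ‖Y' i ω‖} ≤ 4 * u := by
    have hset : MeasurableSet {x : ℕ → B | ∃ i < n, s < ‖x i‖} := by
      measurability
    exact (hcopy.measure_mem_eq hset).le.trans hlarge
  -- truncated variables
  let f : B → B := {x | ‖x‖ ≤ s}.indicator id
  have hf : Measurable f := measurable_id.indicator (measurableSet_le (by fun_prop) (by fun_prop))
  have hfs : ∀ x, ‖f x‖ ≤ s := fun x => by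
    by_cases hx : ‖x‖ ≤ s
    · simp [f, hx]
    · simpa [f, hx] using hs.le
  have hfeq : ∀ x, ‖x‖ ≤ s → f x = x := fun x hx => by simp [f, hx]
  have hfY : ∀ i, {x | ‖Y i x‖ ≤ s}.indicator (Y i) = fun ω => f (Y i ω) := fun i => rfl
  have hX : ∀ i, Measurable fun ω => f (Y i ω) - f (Y' i ω) := fun i =>
    (hf.comp (hY i)).sub (hf.comp (hY' i))
  have hX_ind : iIndepFun (fun i ω => f (Y i ω) - f (Y' i ω)) P :=
    hpair.comp (fun _ z => f z.1 - f z.2) fun _ => by fun_prop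
  have hX_symm : ∀ i, IdentDistrib (fun ω => f (Y i ω) - f (Y' i ω))
      (fun ω => -(f (Y i ω) - f (Y' i ω))) P P := fun i => by
    have := (hswap i).comp (u := fun z : B × B => f z.1 - f z.2) (by fun_prop)
    simpa [Function.comp_def] using this
  have hX_prob : P {ω | ε * s < ‖∑ i ∈ Finset.range n, (f (Y i ω) - f (Y' i ω))‖} ≤ 9 * u := by
    have hsub : {ω | ε * s < ‖∑ i ∈ Finset.range n, (f (Y i ω) - f (Y' i ω))‖} ⊆
        {ω | ε * s < ‖∑ i ∈ Finset.range n, (Y i ω - Y' i ω)‖} ∪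
          ({ω | ∃ i < n, s < ‖Y i ω‖} ∪ {ω | ∃ i < n, s < ‖Y' i ω‖}) := by
      intro ω hω
      by_contra hcon
      simp only [Set.mem_union, not_or, Set.mem_ofPred_eq, not_exists, not_and, not_lt]
        at hcon hω
      obtain ⟨h1, h2, h3⟩ := hcon
      refine hω.not_ge (le_of_eq_of_le ?_ h1)
      congr 1
      refine Finset.sum_congr rfl fun i hi => ?_
      rw [hfeq _ (h2 i (Finset.mem_range.1 hi)), hfeq _ (h3 i (Finset.mem_range.1 hi))]
    calc _ ≤ u + (4 * u + 4 * u) := (measure_mono hsub).trans ((measure_union_le _ _).trans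
          (add_le_add hu ((measure_union_le _ _).trans (add_le_add hlarge hlarge'))))
      _ = 9 * u := by ring
  -- With tail `9 * u` and terms bounded by `2 * s`, the bound is 2εs + 4·9u·2s, whence the 72.
  have hmean := lintegral_enorm_sum_le_of_measure_le hX hX_ind hX_symm (c := 2 * s)
    (by positivity) (fun i ω => (norm_sub_le _ _).trans (by linarith [hfs (Y i ω), hfs (Y' i ω)]))
    n hX_prob hu9
  -- centering
  have hint : ∀ i, Integrable (fun ω => f (Y i ω)) P := fun i =>
    Integrable.of_bound (hf.comp (hY i)).aestronglyMeasurable s (ae_of_all _ fun ω => hfs _)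
  have hg : Measurable fun x : ℕ → B => ∑ i ∈ Finset.range n, f (x i) := by fun_prop
  have hm : Measurable fun ω i => Y i ω := measurable_pi_lambda _ hY
  have hm' : Measurable fun ω i => Y' i ω := measurable_pi_lambda _ hY'
  have hcenter := lintegral_enorm_sub_integral_le (hg.comp hm) (hg.comp hm')
    (integrable_finsetSum _ fun i _ => hint i) (hcopy.comp hg) (hcopy_indep.comp hg hg)
  simp only [Function.comp_def] at hcenter
  rw [integral_finsetSum _ fun i _ => hint i] at hcenter
  simp only [← Finset.sum_sub_distrib] at hcenter
  simp only [Finset.sum_sub_distrib] at hcenter hmean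
  have hbound := hcenter.trans hmean
  simp only [hfY]
  have hsub : {ω | δ * s ≤ ‖∑ i ∈ Finset.range n, Y i ω -
      ∑ i ∈ Finset.range n, ∫ ω', f (Y i ω') ∂P‖} ⊆ {ω | ∃ i < n, s < ‖Y i ω‖} ∪
      {ω | ENNReal.ofReal (δ * s) ≤ ‖∑ i ∈ Finset.range n, f (Y i ω) -
        ∑ i ∈ Finset.range n, ∫ ω', f (Y i ω') ∂P‖ₑ} := by
    intro ω hω
    by_cases h : ω ∈ {ω | ∃ i < n, s < ‖Y i ω‖}
    · exact Or.inl h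
    · right
      simp only [Set.mem_ofPred_eq, not_exists, not_and, not_lt] at h hω ⊢
      rw [← ofReal_norm, Finset.sum_congr rfl fun i hi => hfeq _ (h i (Finset.mem_range.1 hi))]
      exact ENNReal.ofReal_le_ofReal hω
  refine (measure_mono hsub).trans ((measure_union_le _ _).trans (add_le_add hlarge ?_))
  refine (meas_ge_le_lintegral_div (by fun_prop) (by simpa using by positivity)
    ENNReal.ofReal_ne_top).trans ?_
  rw [ENNReal.ofReal_mul hδ.le]
  refine le_trans ?_ (ENNReal.mul_div_mul_right _ _ (c := ENNReal.ofReal s) (by simpa using hs)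
    ENNReal.ofReal_ne_top).le
  gcongr
  refine hbound.trans (le_of_eq ?_)
  rw [ENNReal.ofReal_mul hε.le, ENNReal.ofReal_mul zero_le_two, ENNReal.ofReal_ofNat]
  ring

end IndependentCopy

/-! ### Passage to the limit -/

section Limits

variable {Ω : Type*} [MeasurableSpace Ω] {P : Measure Ω} {B : Type*} [NormedAddCommGroup B]

lemma tendstoInMeasure_sub_zero {u v : ℕ → Ω → B}
    (hu : TendstoInMeasure P u atTop fun _ => 0) (hv : TendstoInMeasure P v atTop fun _ => 0) :
    TendstoInMeasure P (fun n ω => u n ω - v n ω) atTop fun _ => 0 := by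
  rw [tendstoInMeasure_iff_norm] at *
  intro ε hε
  have h := (hu (ε / 2) (by positivity)).add (hv (ε / 2) (by positivity))
  rw [add_zero] at h
  refine tendsto_of_tendsto_of_tendsto_of_le_of_le tendsto_const_nhds h (fun _ => zero_le)
    fun n => (measure_mono fun ω hω => ?_).trans (measure_union_le _ _)
  by_contra hcon
  simp only [Set.mem_union, not_or, Set.mem_ofPred_eq, not_le, sub_zero] at hcon hω
  have := norm_sub_le (u n ω) (v n ω)
  linarith [hcon.1, hcon.2]

lemma tendstoInMeasure_zero_of_identDistrib [MeasurableSpace B] [BorelSpace B]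
    {u v : ℕ → Ω → B} (huv : ∀ n, IdentDistrib (u n) (v n) P P)
    (hv : TendstoInMeasure P v atTop fun _ => 0) : TendstoInMeasure P u atTop fun _ => 0 := by
  rw [tendstoInMeasure_iff_norm] at *
  intro ε hε
  refine (hv ε hε).congr fun n => ?_
  have hset : MeasurableSet {x : B | ε ≤ ‖x - 0‖} :=
    measurableSet_le measurable_const (by simpa using measurable_norm)
  exact ((huv n).measure_mem_eq hset).symm

/-- A deterministic event has probability 0 or 1, so probability below 1 excludes it. -/
lemma tendsto_zero_of_tendstoInMeasure_const [IsProbabilityMeasure P] {x : ℕ → B}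
    (h : TendstoInMeasure P (fun n _ => x n) atTop fun _ => 0) : Tendsto x atTop (𝓝 0) := by
  rw [tendstoInMeasure_iff_norm] at h
  rw [Metric.tendsto_atTop']
  intro ε hε
  have h1 := (tendsto_order.1 (h ε hε)).2 1 one_pos
  obtain ⟨N, hN⟩ := eventually_atTop.1 h1
  refine ⟨N, fun n hn => ?_⟩
  by_contra hcon
  have h2 := hN n hn.le
  simp only [dist_zero_right, not_lt] at hcon
  simp [hcon] at h2

variable [NormedSpace ℝ B]

lemma le_norm_inv_smul_iff {a ε : ℝ} (ha : 0 < a) {x : B} :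
    ε ≤ ‖a⁻¹ • x - 0‖ ↔ ε * a ≤ ‖x‖ := by
  rw [sub_zero, norm_smul, norm_inv, Real.norm_of_nonneg ha.le, inv_mul_eq_div, le_div_iff₀ ha]

variable [MeasurableSpace B] [BorelSpace B] [SecondCountableTopology B] [IsProbabilityMeasure P]

/-- Late indices follow from the limsup bound and monotonicity of `a`; the finitely many early ones
from `a n → ∞`. -/
lemma eventually_forall_measure_lt_norm_le {Y : ℕ → Ω → B} (hY : ∀ i, Measurable (Y i))
    {a : ℕ → ℝ} (ha_pos : ∀ n, 0 < a n) (ha_mono : Monotone a) (ha_top : Tendsto a atTop atTop)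
    (hlimsup : limsup (fun n => P {ω | a n / 2 < ‖Y n ω‖}) atTop < 1 / 2) :
    ∀ᶠ n in atTop, ∀ i < n + 1, P {ω | a n / 2 < ‖Y i ω‖} ≤ 2⁻¹ := by
  obtain ⟨N, hN⟩ := eventually_atTop.1 (eventually_lt_of_limsup_lt hlimsup)
  have hfix : ∀ i, ∀ᶠ n in atTop, P {ω | a n / 2 < ‖Y i ω‖} ≤ 2⁻¹ := by
    intro i
    have hlim : ∀ ω, Tendsto (fun n => (a n)⁻¹ • Y i ω) atTop (𝓝 0) := fun ω => by
      simpa using (tendsto_inv_atTop_zero.comp ha_top).smul_const (Y i ω)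
    have h := tendstoInMeasure_of_tendsto_ae (μ := P)
      (fun n => ((hY i).const_smul (a n)⁻¹).aestronglyMeasurable) (ae_of_all _ hlim)
    rw [tendstoInMeasure_iff_norm] at h
    filter_upwards [(tendsto_order.1 (h (1 / 2) (by norm_num))).2 2⁻¹ (by simp)] with n hn
    refine (measure_mono fun ω hω => ?_).trans hn.le
    have hω' : a n / 2 < ‖Y i ω‖ := hω
    exact (le_norm_inv_smul_iff (ha_pos n)).2 (by linarith)
  have hall := (eventually_all_finset (Finset.range N)).2 fun i _ => hfix i
  filter_upwards [hall] with n hn i hi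
  by_cases hiN : i < N
  · exact hn i (Finset.mem_range.2 hiN)
  · refine le_trans (measure_mono fun ω hω => ?_)
      ((hN i (not_lt.1 hiN)).le.trans (one_div 2).le)
    have hω' : a n / 2 < ‖Y i ω‖ := hω
    have := ha_mono (Nat.lt_succ_iff.1 hi)
    exact lt_of_le_of_lt (by linarith) hω'

variable {Y Y' : ℕ → Ω → B}

/-- Almost sure convergence to zero of the symmetrized sums gives almost sure convergence to
zero of the sums with some deterministic centering. -/
lemma exists_ae_tendsto_inv_smul_sum_sub
    (hY : ∀ i, Measurable (Y i)) (hY' : ∀ i, Measurable (Y' i))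
    (hcopy_indep : IndepFun (fun ω i => Y i ω) (fun ω i => Y' i ω) P) {a : ℕ → ℝ}
    (h : ∀ᵐ ω ∂P, Tendsto
      (fun n => (a n)⁻¹ • ∑ i ∈ Finset.range (n + 1), (Y i ω - Y' i ω)) atTop (𝓝 0)) :
    ∃ x : ℕ → B, ∀ᵐ ω ∂P, Tendsto
      (fun n => (a n)⁻¹ • (∑ i ∈ Finset.range (n + 1), Y i ω - x n)) atTop (𝓝 0) := by
  have hm : Measurable fun ω i => Y i ω := measurable_pi_lambda _ hY
  have hm' : Measurable fun ω i => Y' i ω := measurable_pi_lambda _ hY'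
  have hprod := (indepFun_iff_map_prod_eq_prod_map_map hm'.aemeasurable hm.aemeasurable).1
    hcopy_indep.symm
  have : IsProbabilityMeasure (P.map fun ω i => Y' i ω) :=
    Measure.isProbabilityMeasure_map hm'.aemeasurable
  have hset : MeasurableSet {z : (ℕ → B) × (ℕ → B) | Tendsto
      (fun n => (a n)⁻¹ • ∑ i ∈ Finset.range (n + 1), (z.2 i - z.1 i)) atTop (𝓝 0)} :=
    measurableSet_tendsto _ fun n => by fun_prop
  have h1 := (ae_map_iff (hm'.prodMk hm).aemeasurable hset).2 h
  rw [hprod] at h1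
  -- A typical path `y` of `Y'` is frozen; its partial sums are the centering.
  obtain ⟨y, hy⟩ := (Measure.ae_ae_of_ae_prod h1).exists
  refine ⟨fun n => ∑ i ∈ Finset.range (n + 1), y i, ?_⟩
  filter_upwards [ae_of_ae_map hm.aemeasurable hy] with ω hω
  simpa only [Finset.sum_sub_distrib] using hω

variable [CompleteSpace B]

lemma tendstoInMeasure_sub_truncated_mean
    (hY : ∀ i, Measurable (Y i)) (hY' : ∀ i, Measurable (Y' i)) (hindep : iIndepFun Y P)
    (hcopy : IdentDistrib (fun ω i => Y' i ω) (fun ω i => Y i ω) P P)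
    (hcopy_indep : IndepFun (fun ω i => Y i ω) (fun ω i => Y' i ω) P)
    {a : ℕ → ℝ} (ha_pos : ∀ n, 0 < a n)
    (ha : ∀ᶠ n in atTop, ∀ i < n + 1, P {ω | a n / 2 < ‖Y i ω‖} ≤ 2⁻¹)
    (h : TendstoInMeasure P
      (fun n ω => (a n)⁻¹ • ∑ i ∈ Finset.range (n + 1), (Y i ω - Y' i ω)) atTop fun _ => 0) :
    TendstoInMeasure P
      (fun n ω => (a n)⁻¹ • (∑ i ∈ Finset.range (n + 1), Y i ω -
        ∑ i ∈ Finset.range (n + 1), ∫ ω', {x | ‖Y i x‖ ≤ a n}.indicator (Y i) ω' ∂P))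
      atTop fun _ => 0 := by
  rw [tendstoInMeasure_iff_norm] at h ⊢
  intro δ hδ
  simp only [le_norm_inv_smul_iff (ha_pos _)] at h ⊢
  rw [ENNReal.tendsto_nhds_zero]
  intro η hη
  have hδ0 : ENNReal.ofReal δ ≠ 0 := by simpa using hδ
  have hg1 : Tendsto (fun ε : ℝ => 2 * ENNReal.ofReal ε / ENNReal.ofReal δ) (𝓝[>] 0) (𝓝 0) := by
    have h1 : Tendsto (fun ε : ℝ => ENNReal.ofReal ε) (𝓝[>] 0) (𝓝 0) := by
      simpa using (ENNReal.continuous_ofReal.tendsto 0).mono_left nhdsWithin_le_nhds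
    have h2 := ENNReal.Tendsto.div_const (ENNReal.Tendsto.const_mul (a := 2) h1
      (Or.inr ENNReal.ofNat_ne_top)) (Or.inr hδ0)
    simpa using h2
  -- `ε` is fixed first, to absorb the term 2ε/δ; the terms in `u` then vanish as `n` grows.
  obtain ⟨ε, hεη, hε4, hε⟩ := ((ENNReal.tendsto_nhds_zero.1 hg1 (η / 2)
    (ENNReal.half_pos hη.ne')).and ((Ioc_mem_nhdsGT (by norm_num : (0 : ℝ) < 4⁻¹)))).exists
  have hu := h ε hε4
  have h9 : ∀ᶠ n in atTop, 9 * P {ω | ε * a n ≤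
      ‖∑ i ∈ Finset.range (n + 1), (Y i ω - Y' i ω)‖} ≤ 4⁻¹ := by
    have := ENNReal.Tendsto.const_mul (a := 9) hu (Or.inr ENNReal.ofNat_ne_top)
    rw [mul_zero] at this
    exact ENNReal.tendsto_nhds_zero.1 this _ (by simp)
  have h76 := (ENNReal.Tendsto.const_mul (a := 4) hu (Or.inr ENNReal.ofNat_ne_top)).add
    (ENNReal.Tendsto.div_const (ENNReal.Tendsto.const_mul (a := 72) hu
      (Or.inr ENNReal.ofNat_ne_top)) (Or.inr hδ0))
  simp only [mul_zero, ENNReal.zero_div, add_zero] at h76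
  filter_upwards [ha, h9, ENNReal.tendsto_nhds_zero.1 h76 _ (ENNReal.half_pos hη.ne')]
    with n hn hn9 hn76
  have hlt : P {ω | ε * a n < ‖∑ i ∈ Finset.range (n + 1), (Y i ω - Y' i ω)‖} ≤
      P {ω | ε * a n ≤ ‖∑ i ∈ Finset.range (n + 1), (Y i ω - Y' i ω)‖} :=
    measure_mono fun ω hω => by
      simp only [Set.mem_ofPred_eq] at hω ⊢
      exact hω.le
  refine (measure_le_norm_sum_sub_truncated_mean_le hY hY' hindep hcopy hcopy_indep (ha_pos n)
    hε4 hε hδ hn hlt hn9).trans ?_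
  rw [ENNReal.add_div, add_left_comm]
  exact (add_le_add hεη hn76).trans (ENNReal.add_halves η).le

end Limits

/-- Sequences are indexed from `0`: `Y i`, `Y' i`, `a n` stand for the terms with numbers
`i + 1`, `i + 1`, `n + 1`, so the partial sum with `n + 1` terms, over `Finset.range (n + 1)`,
is normalized by `a n`. -/
theorem theorem3p1 {Ω : Type*} [MeasurableSpace Ω] (P : Measure Ω) [IsProbabilityMeasure P]
    {B : Type*} [NormedAddCommGroup B] [NormedSpace ℝ B] [CompleteSpace B]
    [TopologicalSpace.SeparableSpace B] [MeasurableSpace B] [BorelSpace B]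
    (Y Y' : ℕ → Ω → B)
    (hY : ∀ i, Measurable (Y i)) (hY' : ∀ i, Measurable (Y' i))
    -- the `Y i` are independent
    (hindep : iIndepFun Y P)
    -- the sequence `Y'` is an independent copy of the sequence `Y`
    (hcopy : IdentDistrib (fun ω i => Y' i ω) (fun ω i => Y i ω) P P)
    (hcopy_indep : IndepFun (fun ω i => Y i ω) (fun ω i => Y' i ω) P)
    (a : ℕ → ℝ) (ha_pos : ∀ n, 0 < a n) (ha_mono : Monotone a)
    (ha_top : Tendsto a atTop atTop)
    (hlimsup : limsup (fun n => P {ω | a n / 2 < ‖Y n ω‖}) atTop < 1 / 2) :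
    -- weak law
    (TendstoInMeasure P
        (fun n ω => (a n)⁻¹ • (∑ i ∈ Finset.range (n + 1), Y i ω -
          ∑ i ∈ Finset.range (n + 1), ∫ ω', {x | ‖Y i x‖ ≤ a n}.indicator (Y i) ω' ∂P))
        atTop (fun _ => 0) ↔
      TendstoInMeasure P
        (fun n ω => (a n)⁻¹ • ∑ i ∈ Finset.range (n + 1), (Y i ω - Y' i ω))
        atTop (fun _ => 0)) ∧
    -- strong law
    ((∀ᵐ ω ∂P, Tendsto
        (fun n => (a n)⁻¹ • (∑ i ∈ Finset.range (n + 1), Y i ω -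
          ∑ i ∈ Finset.range (n + 1), ∫ ω', {x | ‖Y i x‖ ≤ a n}.indicator (Y i) ω' ∂P))
        atTop (𝓝 0)) ↔
      (∀ᵐ ω ∂P, Tendsto
        (fun n => (a n)⁻¹ • ∑ i ∈ Finset.range (n + 1), (Y i ω - Y' i ω))
        atTop (𝓝 0))) := by
  have : SecondCountableTopology B := UniformSpace.secondCountable_of_separable B
  have ha := eventually_forall_measure_lt_norm_le hY ha_pos ha_mono ha_top hlimsup
  set γ : ℕ → B := fun n =>
    ∑ i ∈ Finset.range (n + 1), ∫ ω', {x | ‖Y i x‖ ≤ a n}.indicator (Y i) ω' ∂P with hγ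
  have hdiff : ∀ n ω, (a n)⁻¹ • ∑ i ∈ Finset.range (n + 1), (Y i ω - Y' i ω) =
      (a n)⁻¹ • (∑ i ∈ Finset.range (n + 1), Y i ω - γ n) -
        (a n)⁻¹ • (∑ i ∈ Finset.range (n + 1), Y' i ω - γ n) := fun n ω => by
    rw [← smul_sub, sub_sub_sub_cancel_right, Finset.sum_sub_distrib]
  have hweak := tendstoInMeasure_sub_truncated_mean hY hY' hindep hcopy hcopy_indep ha_pos ha
  refine ⟨⟨fun h => ?_, hweak⟩, fun h => ?_, fun h => ?_⟩
  · have h' : TendstoInMeasure P (fun n ω => (a n)⁻¹ •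
        (∑ i ∈ Finset.range (n + 1), Y' i ω - γ n)) atTop fun _ => 0 :=
      tendstoInMeasure_zero_of_identDistrib (fun n => hcopy.comp
        (u := fun x : ℕ → B => (a n)⁻¹ • (∑ i ∈ Finset.range (n + 1), x i - γ n))
        (by fun_prop)) h
    simp only [hdiff]
    exact tendstoInMeasure_sub_zero h h'
  · have hset : MeasurableSet {x : ℕ → B | Tendsto
        (fun n => (a n)⁻¹ • (∑ i ∈ Finset.range (n + 1), x i - γ n)) atTop (𝓝 0)} :=
      measurableSet_tendsto _ fun n => by fun_prop
    -- Convergence is an event of the whole sequence, so equality of laws carries it to `Y'`.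
    filter_upwards [h, hcopy.symm.ae_snd hset h] with ω h1 h2
    simp only [hdiff]
    simpa using h1.sub h2
  · obtain ⟨x, hx⟩ := exists_ae_tendsto_inv_smul_sum_sub hY hY' hcopy_indep h
    have h1 := hweak (tendstoInMeasure_of_tendsto_ae
      (fun n => Measurable.aestronglyMeasurable (by fun_prop)) h)
    have h2 := tendstoInMeasure_of_tendsto_ae
      (fun n => Measurable.aestronglyMeasurable (by fun_prop)) hx
    -- The random sums cancel, leaving the deterministic sequence (x_n - γ_n)/a_n.
    have h3 := tendstoInMeasure_sub_zero h1 h2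
    simp only [← smul_sub, sub_sub_sub_cancel_left] at h3
    have h4 := tendsto_zero_of_tendstoInMeasure_const h3
    filter_upwards [hx] with ω hω
    have h5 := hω.add h4
    simp only [← smul_add, sub_add_sub_cancel, add_zero] at h5
    exact h5
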